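/- Let $\mathbb K$ be $\mathbb R$ or $\mathbb C$. All spaces are Banach spaces over $\mathbb K$ and all operators are linear and continuous; $\mathfrak L(A,B)$ is the space of operators $A\to B$. For $n\ge 1$, an $n$-exact sequence between $Y$ and $X$ is an exact sequence $0\to Y\to E_1\to\cdots\to E_n\to X\to 0$ of Banach spaces and operators, and $\operatorname{Ext}^n(X,Y)$ is the collection of these sequences modulo the equivalence relation generated by the existence of a morphism of sequences which is the identity on $Y$ and on $X$. It is a vector space under the Baer sum and the scalar multiplication given by pushout along the homotheties of $Y$. A Banach space $\mathcal I$ is injective if every operator from a closed subspace of a Banach space into $\mathcal I$ extends to the whole space. Fix for each Banach space $Z$ an injective presentation, that is, a short exact sequence $$0\to Z\xrightarrow{\ \iota\ }\mathcal I(Z)\xrightarrow{\ \pi\ }c\kappa(Z)\to 0\qquad(\mathscr I_Z)$$ with $\mathcal I(Z)$ injective, and put $c\kappa^0(Z)=Z$, $c\kappa^{k+1}(Z)=c\kappa(c\kappa^k(Z))$ and $\mathcal I_{k+1}=\mathcal I(c\kappa^{k}(Y))$. **Proposition.** Let $X$ and $Y$ be Banach spaces. Then, for every $n\ge 1$, $$\operatorname{Ext}^n(X,Y)=\operatorname{Ext}^{n-1}(X,c\kappa(Y))=\cdots=\operatorname{Ext}^1(X,c\kappa^{n-1}(Y))=\frac{\mathfrak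 L(X,c\kappa^n(Y))}{\pi_*[\mathfrak L(X,\mathcal I_n)]},$$ where $\pi_*[\mathfrak L(X,\mathcal I_n)]$ is the space of those operators $X\to c\kappa^n(Y)$ that lift to $\mathcal I_n$ through $\pi:\mathcal I_n\to c\kappa^n(Y)$. More precisely: 1. whenever $i\ge 0$, $j\ge 2$ and $i+j=n$, splicing with $\mathscr I_{c\kappa^i(Y)}$ through $c\kappa^{i+1}(Y)$, that is, $[\mathscr F]\mapsto[\mathscr I_{c\kappa^i(Y)}\mathscr F]$, is a well-defined linear isomorphism from $\operatorname{Ext}^{j-1}(X,c\kappa^{i+1}(Y))$ onto $\operatorname{Ext}^{j}(X,c\kappa^{i}(Y))$; 2. the map sending $a\in\mathfrak L(X,c\kappa^n(Y))$ to the class of the pullback of $\mathscr I_{c\kappa^{n-1}(Y)}$ along $a$ induces a linear isomorphism from $\mathfrak L(X,c\kappa^n(Y))/\pi_*[\mathfrak L(X,\mathcal I_n)]$ onto $\operatorname{Ext}^1(X,c\kappa^{n-1}(Y))$. -/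

import Mathlib

universe u v

noncomputable section

namespace BanachExt

/-! ### Banach spaces, pushouts, pullbacks, injective spaces -/

/-- A Banach space over `𝕜` (in practice `ℝ` or `ℂ`). -/
structure Ban (𝕜 : Type v) [RCLike 𝕜] where
  /-- the underlying set -/
  carrier : Type u
  [instNorm : NormedAddCommGroup carrier]
  [instSpace : NormedSpace 𝕜 carrier]
  [instComplete : CompleteSpace carrier]

namespace Ban

variable {𝕜 : Type v} [RCLike 𝕜]

instance : CoeSort (Ban.{u, v} 𝕜) (Type u) := ⟨Ban.carrier⟩

instance (A : Ban.{u, v} 𝕜) : NormedAddCommGroup A := A.instNorm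
instance (A : Ban.{u, v} 𝕜) : NormedSpace 𝕜 A := A.instSpace
instance (A : Ban.{u, v} 𝕜) : CompleteSpace A := A.instComplete

/-- The zero space. -/
abbrev zero (𝕜 : Type v) [RCLike 𝕜] : Ban.{u, v} 𝕜 := ⟨PUnit.{u + 1}⟩

/-- The direct sum of two Banach spaces (with the maximum norm, which is equivalent to the sum
norm). -/
abbrev prod (A B : Ban.{u, v} 𝕜) : Ban.{u, v} 𝕜 := ⟨A × B⟩

/-- A Banach space `I` is injective if every operator into `I` from a closed subspace (equivalently,
from an isomorphic copy of a closed subspace) of a Banach space extends to the whole space. -/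
def IsInjective (I : Ban.{u, v} 𝕜) : Prop :=
  ∀ (A B : Ban.{u, v} 𝕜) (j : A →L[𝕜] B), Function.Injective j → IsClosed (Set.range j) →
    ∀ T : A →L[𝕜] I, ∃ S : B →L[𝕜] I, S ∘L j = T

/-- The closed subspace `closure {(f a, -β a)}` of `E ⊕ B` by which one divides to form the
pushout. -/
def poRel {A E B : Ban.{u, v} 𝕜} (f : A →L[𝕜] E) (β : A →L[𝕜] B) : Submodule 𝕜 (E × B) :=
  (f.prod (-β)).range.topologicalClosure

instance {A E B : Ban.{u, v} 𝕜} (f : A →L[𝕜] E) (β : A →L[𝕜] B) :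
    IsClosed (poRel f β : Set (E × B)) :=
  Submodule.isClosed_topologicalClosure _

/-- The pushout space of `f : A → E` and `β : A → B`. -/
def po {A E B : Ban.{u, v} 𝕜} (f : A →L[𝕜] E) (β : A →L[𝕜] B) : Ban.{u, v} 𝕜 :=
  ⟨(E × B) ⧸ poRel f β⟩

/-- The canonical operator `E → PO`. -/
def poInl {A E B : Ban.{u, v} 𝕜} (f : A →L[𝕜] E) (β : A →L[𝕜] B) : E →L[𝕜] po f β :=
  (poRel f β).mkQL ∘L ContinuousLinearMap.inl 𝕜 E B

/-- The canonical operator `B → PO`. -/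
def poInr {A E B : Ban.{u, v} 𝕜} (f : A →L[𝕜] E) (β : A →L[𝕜] B) : B →L[𝕜] po f β :=
  (poRel f β).mkQL ∘L ContinuousLinearMap.inr 𝕜 E B

/-- The operator out of the pushout given by its universal property. -/
def poDesc {A E B G : Ban.{u, v} 𝕜} (f : A →L[𝕜] E) (β : A →L[𝕜] B)
    (g : E →L[𝕜] G) (h : B →L[𝕜] G) (w : g ∘L f = h ∘L β) : po f β →L[𝕜] G :=
  (poRel f β).liftQL (g.coprod h) (by
    refine Submodule.topologicalClosure_minimal _ ?_ (ContinuousLinearMap.isClosed_ker _)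
    rintro _ ⟨a, rfl⟩
    have := DFunLike.congr_fun w a
    simp only [ContinuousLinearMap.comp_apply] at this
    simp [this])

section po
variable {A E B G : Ban.{u, v} 𝕜} (f : A →L[𝕜] E) (β : A →L[𝕜] B)

theorem po_cond (a : A) : poInl f β (f a) = poInr f β (β a) := by
  refine (Submodule.Quotient.eq (poRel f β)).2 (Submodule.le_topologicalClosure _ ?_)
  exact ⟨a, by simp⟩

theorem po_surj (x : po f β) : ∃ e b, x = poInl f β e + poInr f β b := by
  obtain ⟨⟨e, b⟩, rfl⟩ := Submodule.Quotient.mk_surjective _ x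
  refine ⟨e, b, ?_⟩
  have : ((e, b) : E × B) = (e, 0) + (0, b) := by simp
  rw [this]
  rfl

@[simp] theorem poDesc_inl (g : E →L[𝕜] G) (h : B →L[𝕜] G) (w) (e : E) :
    poDesc f β g h w (poInl f β e) = g e := by
  have : poDesc f β g h w (poInl f β e) = g.coprod h (e, 0) := rfl
  simp [this]

@[simp] theorem poDesc_inr (g : E →L[𝕜] G) (h : B →L[𝕜] G) (w) (b : B) :
    poDesc f β g h w (poInr f β b) = h b := by
  have : poDesc f β g h w (poInr f β b) = g.coprod h (0, b) := rfl
  simp [this]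

theorem poInr_injective (hf : Function.Injective f) (hc : IsClosed (Set.range f)) :
    Function.Injective (poInr f β) := by
  obtain ⟨K, hK⟩ := f.antilipschitz_of_injective_of_isClosed_range hf hc
  have hcl : IsClosed (Set.range (f.prod (-β))) := by
    have : AntilipschitzWith K (f.prod (-β)) := by
      refine ContinuousLinearMap.antilipschitz_of_bound _ fun a => ?_
      refine (ZeroHomClass.bound_of_antilipschitz f hK a).trans ?_
      gcongr
      exact le_max_left _ _
    exact this.isClosed_range (f.prod (-β)).uniformContinuous
  rw [injective_iff_map_eq_zero]
  intro b hb
  have h1 : ((0, b) : E × B) ∈ poRel f β := (Submodule.Quotient.mk_eq_zero _).1 hb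
  rw [poRel, IsClosed.submodule_topologicalClosure_eq hcl] at h1
  obtain ⟨a, ha⟩ := h1
  simp only [ContinuousLinearMap.coe_coe, ContinuousLinearMap.prod_apply, Prod.mk.injEq] at ha
  have : a = 0 := hf (by simpa using ha.1)
  simpa [this] using ha.2.symm

theorem ker_poDesc (g : E →L[𝕜] G) (w) (h : f.range = g.ker) :
    (poDesc f β g 0 w).ker = (poInr f β).range := by
  ext x
  obtain ⟨e, b, rfl⟩ := po_surj f β x
  constructor
  · intro hx
    have hx : g e = 0 := by simpa using hx
    obtain ⟨a, rfl⟩ : e ∈ f.range := h ▸ hx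
    refine ⟨β a + b, ?_⟩
    have := po_cond f β a
    simp_all
  · rintro ⟨b', hb⟩
    have := congrArg (poDesc f β g 0 w) hb
    have : g e = 0 := by simpa [eq_comm] using this
    simpa using this

theorem range_poDesc (g : E →L[𝕜] G) (w) :
    Set.range (poDesc f β g 0 w) = Set.range g := by
  ext x
  constructor
  · rintro ⟨y, rfl⟩
    obtain ⟨e, b, rfl⟩ := po_surj f β y
    exact ⟨e, by simp⟩
  · rintro ⟨e, rfl⟩
    exact ⟨poInl f β e, by simp⟩

end po

/-- The pullback space of `g : E → X` and `α : X' → X`, a closed subspace of `E ⊕ X'`. -/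
def pb {E X X' : Ban.{u, v} 𝕜} (g : E →L[𝕜] X) (α : X' →L[𝕜] X) : Ban.{u, v} 𝕜 :=
  @Ban.mk 𝕜 _ ((g ∘L ContinuousLinearMap.fst 𝕜 E X' - α ∘L ContinuousLinearMap.snd 𝕜 E X').ker)
    _ _ (ContinuousLinearMap.isClosed_ker _).completeSpace_coe

section pb
variable {A E X X' : Ban.{u, v} 𝕜} (g : E →L[𝕜] X) (α : X' →L[𝕜] X)

/-- The canonical operator `PB → E`. -/
def pbFst : pb g α →L[𝕜] E :=
  ContinuousLinearMap.fst 𝕜 E X' ∘L Submodule.subtypeL _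

/-- The canonical operator `PB → X'`. -/
def pbSnd : pb g α →L[𝕜] X' :=
  ContinuousLinearMap.snd 𝕜 E X' ∘L Submodule.subtypeL _

/-- The operator into the pullback given by its universal property. -/
def pbLift (p : A →L[𝕜] E) (q : A →L[𝕜] X') (w : g ∘L p = α ∘L q) : A →L[𝕜] pb g α :=
  (p.prod q).codRestrict _ (fun a => by
    have := DFunLike.congr_fun w a
    simp only [ContinuousLinearMap.comp_apply] at this
    simp [this])

theorem pb_cond (x : pb g α) : g (pbFst g α x) = α (pbSnd g α x) := by
  exact sub_eq_zero.1 (LinearMap.mem_ker.1 x.2)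

theorem pb_ext {x y : pb g α} (h1 : pbFst g α x = pbFst g α y) (h2 : pbSnd g α x = pbSnd g α y) :
    x = y :=
  Subtype.ext (Prod.ext h1 h2)

@[simp] theorem pbFst_lift (p : A →L[𝕜] E) (q : A →L[𝕜] X') (w) (a : A) :
    pbFst g α (pbLift g α p q w a) = p a := rfl

@[simp] theorem pbSnd_lift (p : A →L[𝕜] E) (q : A →L[𝕜] X') (w) (a : A) :
    pbSnd g α (pbLift g α p q w a) = q a := rfl

theorem pb_exists (e : E) (x : X') (h : g e = α x) :
    ∃ y : pb g α, pbFst g α y = e ∧ pbSnd g α y = x :=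
  ⟨⟨(e, x), by simp [h]⟩, rfl, rfl⟩

end pb

end Ban

variable {𝕜 : Type v} [RCLike 𝕜]

/-! ### Diagrams, exact sequences and their morphisms -/

/-- `Diagram X n A` is the type of diagrams `A → E₁ → ⋯ → Eₙ → X` of Banach spaces and operators,
with `n` terms strictly between `A` and `X`. -/
inductive Diagram (X : Ban.{u, v} 𝕜) : ℕ → Ban.{u, v} 𝕜 → Type (max (u + 1) v)
  /-- the diagram `A → X` -/
  | last {A : Ban.{u, v} 𝕜} (f : A →L[𝕜] X) : Diagram X 0 A
  /-- put an arrow `A → E` in front of a diagram `E → ⋯ → X` -/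
  | cons {n : ℕ} {A E : Ban.{u, v} 𝕜} (f : A →L[𝕜] E) (t : Diagram X n E) : Diagram X (n + 1) A

namespace Diagram

/-- The kernel of the first arrow of a diagram. -/
def ker {X : Ban.{u, v} 𝕜} : {n : ℕ} → {A : Ban.{u, v} 𝕜} → Diagram X n A → Submodule 𝕜 A
  | _, _, last f => f.ker
  | _, _, cons f _ => f.ker

/-- Exactness of `A → E₁ → ⋯ → Eₙ → X → 0` at `E₁, …, Eₙ` and `X`: the image of each arrow is the
kernel of the next one, and the last arrow is surjective. -/
def Exact {X : Ban.{u, v} 𝕜} : {n : ℕ} → {A : Ban.{u, v} 𝕜} → Diagram X n A → Prop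
  | _, _, last f => Function.Surjective f
  | _, _, cons f t => f.range = t.ker ∧ t.Exact

/-- `Mor α φ d d'` says that there is a commutative diagram with rows `d` and `d'`, leftmost
vertical arrow `φ` and rightmost vertical arrow `α`. -/
def Mor {X X' : Ban.{u, v} 𝕜} (α : X →L[𝕜] X') : {n : ℕ} → {A A' : Ban.{u, v} 𝕜} →
    (A →L[𝕜] A') → Diagram X n A → Diagram X' n A' → Prop
  | _, _, _, φ, last f, last f' => f' ∘L φ = α ∘L f
  | _, _, _, φ, cons (E := E) f t, cons (E := E') f' t' =>
      ∃ ψ : E →L[𝕜] E', f' ∘L φ = ψ ∘L f ∧ Mor α ψ t t'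

/-- Compose the first arrow of a diagram with an operator. -/
def precomp {X : Ban.{u, v} 𝕜} : {n : ℕ} → {A B : Ban.{u, v} 𝕜} →
    Diagram X n A → (B →L[𝕜] A) → Diagram X n B
  | _, _, _, last f, p => last (f ∘L p)
  | _, _, _, cons f t, p => cons (f ∘L p) t

/-- Splice `A → E₁ → ⋯ → Eₙ → Z` and `Z → F₁ → ⋯ → Fₘ → X` through `Z`, composing `Eₙ → Z → F₁`. -/
def splice {X Z : Ban.{u, v} 𝕜} {m : ℕ} : {n : ℕ} → {A : Ban.{u, v} 𝕜} →
    Diagram Z n A → Diagram X m Z → Diagram X (m + n) A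
  | _, _, last p, d => d.precomp p
  | _, _, cons f t, d => cons f (t.splice d)

/-- The direct sum of two diagrams, arrow by arrow. -/
def prod {X X' : Ban.{u, v} 𝕜} : {n : ℕ} → {A A' : Ban.{u, v} 𝕜} →
    Diagram X n A → Diagram X' n A' → Diagram (X.prod X') n (A.prod A')
  | _, _, _, last f, last f' => last (f.prodMap f')
  | _, _, _, cons f t, cons f' t' => cons (f.prodMap f') (t.prod t')

/-- For `f : A → E`, `β : A → B` and a diagram `E → E₂ → ⋯` whose first arrow `g` kills the image
of `f`, the diagram `PO → E₂ → ⋯` whose first arrow is induced by `g` and `0 : B → E₂`. -/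
def poTail {X A E B : Ban.{u, v} 𝕜} (f : A →L[𝕜] E) (β : A →L[𝕜] B) : {n : ℕ} →
    (t : Diagram X n E) → f.range ≤ t.ker → Diagram X n (Ban.po f β)
  | _, last g, h => last (Ban.poDesc f β g 0 (by ext a; simpa [ker] using h ⟨a, rfl⟩))
  | _, cons g t, h => cons (Ban.poDesc f β g 0 (by ext a; simpa [ker] using h ⟨a, rfl⟩)) t

/-- The pushout of an exact diagram `A → E₁ → ⋯ → X` along `β : A → B`. -/
def pushout {X B : Ban.{u, v} 𝕜} : {n : ℕ} → {A : Ban.{u, v} 𝕜} → (β : A →L[𝕜] B) →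
    (d : Diagram X (n + 1) A) → d.Exact → Diagram X (n + 1) B
  | _, _, β, cons f t, h => cons (Ban.poInr f β) (t.poTail f β h.1.le)

/-- The pullback along `α : X' → X` of the exact diagram `A → E₁ → ⋯ → X` with first arrow `f` and
remaining part `t`. -/
def pullbackCons {X X' : Ban.{u, v} 𝕜} (α : X' →L[𝕜] X) : {n : ℕ} → {A E : Ban.{u, v} 𝕜} →
    (f : A →L[𝕜] E) → (t : Diagram X n E) → (cons f t).Exact → Diagram X' (n + 1) A
  | _, _, _, f, last g, h =>
      cons (Ban.pbLift g α f 0 (by ext a; simpa [ker] using h.1.le ⟨a, rfl⟩)) (last (Ban.pbSnd g α))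
  | _, _, _, f, cons g t, h => cons f (pullbackCons α g t h.2)

/-- The pullback of an exact diagram `A → E₁ → ⋯ → X` along `α : X' → X`. -/
def pullback {X X' : Ban.{u, v} 𝕜} (α : X' →L[𝕜] X) : {n : ℕ} → {A : Ban.{u, v} 𝕜} →
    (d : Diagram X (n + 1) A) → d.Exact → Diagram X' (n + 1) A
  | _, _, cons f t, h => pullbackCons α f t h

/-- The diagram `A → 0 → ⋯ → 0 → X = X` with `n + 1` terms between `A` and `X`. -/
def zeroTail (X : Ban.{u, v} 𝕜) : (n : ℕ) → (A : Ban.{u, v} 𝕜) → Diagram X (n + 1) A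
  | 0, _ => cons (E := X) 0 (last (ContinuousLinearMap.id 𝕜 X))
  | n + 1, _ => cons (E := Ban.zero 𝕜) 0 (zeroTail X n _)

/-- The zero sequence: `Y → Y ⊕ X → X` when there is one middle term, and
`Y = Y → 0 → ⋯ → 0 → X = X` when there are at least two. -/
def zero (X : Ban.{u, v} 𝕜) : (n : ℕ) → (Y : Ban.{u, v} 𝕜) → Diagram X (n + 1) Y
  | 0, Y => cons (E := Y.prod X) (ContinuousLinearMap.inl 𝕜 Y X)
      (last (ContinuousLinearMap.snd 𝕜 Y X))
  | n + 1, Y => cons (ContinuousLinearMap.id 𝕜 Y) (zeroTail X n Y)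

section lemmas

variable {X X' X'' A A' A'' B : Ban.{u, v} 𝕜} {n m : ℕ}

theorem isClosed_ker (d : Diagram X n A) : IsClosed (d.ker : Set A) := by
  cases d <;> exact ContinuousLinearMap.isClosed_ker _

theorem Mor.refl (d : Diagram X n A) :
    Mor (ContinuousLinearMap.id 𝕜 X) (ContinuousLinearMap.id 𝕜 A) d d := by
  induction d with
  | last f => rfl
  | cons f t ih => exact ⟨_, rfl, ih⟩

theorem Mor.comp {α : X →L[𝕜] X'} {α' : X' →L[𝕜] X''} {φ : A →L[𝕜] A'} {φ' : A' →L[𝕜] A''}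
    {d : Diagram X n A} {d' : Diagram X' n A'} {d'' : Diagram X'' n A''}
    (h : Mor α φ d d') (h' : Mor α' φ' d' d'') : Mor (α' ∘L α) (φ' ∘L φ) d d'' := by
  induction d generalizing A' A'' with
  | last f =>
    cases d' with | last f' =>
    cases d'' with | last f'' =>
    ext x
    exact (DFunLike.congr_fun h' (φ x)).trans (congrArg α' (DFunLike.congr_fun h x))
  | cons f t ih =>
    cases d' with | cons f' t' =>
    cases d'' with | cons f'' t'' =>
    obtain ⟨ψ, h1, h2⟩ := h
    obtain ⟨ψ', h1', h2'⟩ := h'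
    refine ⟨ψ' ∘L ψ, ?_, ih h2 h2'⟩
    ext x
    exact (DFunLike.congr_fun h1' (φ x)).trans (congrArg ψ' (DFunLike.congr_fun h1 x))

theorem Mor.prod {Y Y' C C' : Ban.{u, v} 𝕜} {α : X →L[𝕜] X'} {φ : A →L[𝕜] A'}
    {β : Y →L[𝕜] Y'} {χ : C →L[𝕜] C'} {d : Diagram X n A} {d' : Diagram X' n A'}
    {e : Diagram Y n C} {e' : Diagram Y' n C'} (h : Mor α φ d d') (h' : Mor β χ e e') :
    Mor (X := X.prod Y) (X' := X'.prod Y') (A := A.prod C) (A' := A'.prod C')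
      (α.prodMap β) (φ.prodMap χ) (d.prod e) (d'.prod e') := by
  induction d generalizing A' C C' with
  | last f =>
    cases d' with | last f' =>
    cases e with | last g =>
    cases e' with | last g' =>
    refine ContinuousLinearMap.ext fun x => Prod.ext ?_ ?_
    · exact DFunLike.congr_fun h x.1
    · exact DFunLike.congr_fun h' x.2
  | cons f t ih =>
    cases d' with | cons f' t' =>
    cases e with | cons g s =>
    cases e' with | cons g' s' =>
    obtain ⟨ψ, h1, h2⟩ := h
    obtain ⟨ψ', h1', h2'⟩ := h'
    refine ⟨ψ.prodMap ψ', ?_, ih h2 h2'⟩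
    refine ContinuousLinearMap.ext fun x => Prod.ext ?_ ?_
    · exact DFunLike.congr_fun h1 x.1
    · exact DFunLike.congr_fun h1' x.2

theorem Mor.swap {Y C : Ban.{u, v} 𝕜} (d : Diagram X n A) (e : Diagram Y n C) :
    Mor (X := X.prod Y) (X' := Y.prod X) (A := A.prod C) (A' := C.prod A)
      (ContinuousLinearEquiv.prodComm 𝕜 X Y) (ContinuousLinearEquiv.prodComm 𝕜 A C)
      (d.prod e) (e.prod d) := by
  induction d generalizing C with
  | last f => cases e with | last g => rfl
  | cons f t ih => cases e with | cons g s => exact ⟨_, rfl, ih s⟩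

theorem Mor.assoc {Y C Z D : Ban.{u, v} 𝕜} (d : Diagram X n A) (e : Diagram Y n C)
    (k : Diagram Z n D) :
    Mor (X := (X.prod Y).prod Z) (X' := X.prod (Y.prod Z)) (A := (A.prod C).prod D)
      (A' := A.prod (C.prod D))
      (ContinuousLinearEquiv.prodAssoc 𝕜 X Y Z) (ContinuousLinearEquiv.prodAssoc 𝕜 A C D)
      ((d.prod e).prod k) (d.prod (e.prod k)) := by
  induction d generalizing C D with
  | last f => cases e with | last g => cases k with | last l => rfl
  | cons f t ih =>
    cases e with | cons g s => cases k with | cons l r => exact ⟨_, rfl, ih s r⟩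

theorem Mor.diag (d : Diagram X n A) :
    Mor (X' := X.prod X) (A' := A.prod A)
      ((ContinuousLinearMap.id 𝕜 X).prod (ContinuousLinearMap.id 𝕜 X))
      ((ContinuousLinearMap.id 𝕜 A).prod (ContinuousLinearMap.id 𝕜 A)) d (d.prod d) := by
  induction d with
  | last f => rfl
  | cons f t ih => exact ⟨_, rfl, ih⟩

theorem Mor.precomp {α : X →L[𝕜] X'} {φ : A →L[𝕜] A'} {C C' : Ban.{u, v} 𝕜}
    {d : Diagram X n A} {d' : Diagram X' n A'} (h : Mor α φ d d') {p : C →L[𝕜] A}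
    {p' : C' →L[𝕜] A'} {ψ : C →L[𝕜] C'} (w : p' ∘L ψ = φ ∘L p) :
    Mor α ψ (d.precomp p) (d'.precomp p') := by
  cases d with
  | last f =>
    cases d' with | last f' =>
    ext x
    exact (congrArg f' (DFunLike.congr_fun w x)).trans (DFunLike.congr_fun h (p x))
  | cons f t =>
    cases d' with | cons f' t' =>
    obtain ⟨χ, h1, h2⟩ := h
    refine ⟨χ, ?_, h2⟩
    ext x
    exact (congrArg f' (DFunLike.congr_fun w x)).trans (DFunLike.congr_fun h1 (p x))

theorem Mor.splice {Z Z' : Ban.{u, v} 𝕜} {α : X →L[𝕜] X'} {γ : Z →L[𝕜] Z'} {φ : A →L[𝕜] A'}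
    {s : Diagram Z n A} {s' : Diagram Z' n A'} (hs : Mor γ φ s s')
    {d : Diagram X m Z} {d' : Diagram X' m Z'} (h : Mor α γ d d') :
    Mor α φ (s.splice d) (s'.splice d') := by
  induction s generalizing A' with
  | last p => cases s' with | last p' => exact h.precomp hs
  | cons f t ih =>
    cases s' with | cons f' t' =>
    obtain ⟨ψ, h1, h2⟩ := hs
    exact ⟨ψ, h1, ih h2⟩

theorem ker_precomp (d : Diagram X n A) (p : B →L[𝕜] A) :
    (d.precomp p).ker = d.ker.comap (p : B →ₗ[𝕜] A) := by
  cases d <;> rfl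

theorem Exact.precomp {d : Diagram X n A} (h : d.Exact) {p : B →L[𝕜] A}
    (hp : Function.Surjective p) : (d.precomp p).Exact := by
  cases d with
  | last f => exact Function.Surjective.comp (g := f) h hp
  | cons f t =>
    refine ⟨?_, h.2⟩
    rw [← h.1]
    ext x
    constructor
    · rintro ⟨b, rfl⟩
      exact ⟨p b, rfl⟩
    · rintro ⟨a, rfl⟩
      obtain ⟨b, rfl⟩ := hp a
      exact ⟨b, rfl⟩

theorem ker_splice {Z : Ban.{u, v} 𝕜} (s : Diagram Z n A) {d : Diagram X m Z} (hd : d.ker = ⊥) :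
    (s.splice d).ker = s.ker := by
  cases s with
  | last p => exact (ker_precomp d p).trans (by rw [hd]; rfl)
  | cons f t => rfl

theorem Exact.splice {Z : Ban.{u, v} 𝕜} {s : Diagram Z n A} (hs : s.Exact) {d : Diagram X m Z}
    (h : d.Exact) (hd : d.ker = ⊥) : (s.splice d).Exact := by
  induction s with
  | last p => exact h.precomp hs
  | cons f t ih => exact ⟨hs.1.trans (ker_splice t hd).symm, ih hs.2⟩

theorem ker_prod (d : Diagram X n A) (d' : Diagram X' n A') :
    (d.prod d').ker = d.ker.prod d'.ker := by
  cases d <;> cases d' <;> · ext x; simp [Diagram.prod, ker]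

theorem Exact.prod {d : Diagram X n A} {d' : Diagram X' n A'} (h : d.Exact) (h' : d'.Exact) :
    (d.prod d').Exact := by
  induction d generalizing A' with
  | last f => cases d' with | last f' => exact Function.Surjective.prodMap h h'
  | cons f t ih =>
    cases d' with | cons f' t' =>
    refine ⟨?_, ih h.2 h'.2⟩
    rw [ker_prod, ← h.1, ← h'.1]
    ext x
    simp

section pushout

variable {E : Ban.{u, v} 𝕜} (f : A →L[𝕜] E) (β : A →L[𝕜] B)

theorem ker_poTail (t : Diagram X n E) (h : f.range = t.ker) :
    (t.poTail f β h.le).ker = (Ban.poInr f β).range := by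
  cases t with
  | last g => exact Ban.ker_poDesc f β g _ h
  | cons g t => exact Ban.ker_poDesc f β g _ h

theorem exact_poTail {t : Diagram X n E} (h : f.range = t.ker) (ht : t.Exact) :
    (t.poTail f β h.le).Exact := by
  cases t with
  | last g =>
    have ht : Function.Surjective g := ht
    exact Set.range_eq_univ.1 ((Ban.range_poDesc f β g _).trans ht.range_eq)
  | cons g t =>
    refine ⟨?_, ht.2⟩
    rw [← ht.1]
    exact SetLike.coe_injective (Ban.range_poDesc f β g _)

theorem ker_pushout {d : Diagram X (n + 1) A} (h : d.Exact) (hd : d.ker = ⊥) :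
    (d.pushout β h).ker = ⊥ := by
  cases d with | cons f t =>
  refine LinearMap.ker_eq_bot.2 (Ban.poInr_injective f β (LinearMap.ker_eq_bot.1 hd) ?_)
  have := isClosed_ker t
  rwa [← h.1] at this

theorem exact_pushout {d : Diagram X (n + 1) A} (h : d.Exact) : (d.pushout β h).Exact := by
  cases d with | cons f t =>
  exact ⟨(ker_poTail f β t h.1).symm, exact_poTail f β h.1 h.2⟩

theorem mor_pushout {d : Diagram X (n + 1) A} (h : d.Exact) :
    Mor (ContinuousLinearMap.id 𝕜 X) β d (d.pushout β h) := by
  cases d with | cons f t =>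
  refine ⟨Ban.poInl f β, ?_, ?_⟩
  · ext a
    exact (Ban.po_cond f β a).symm
  · cases t with
    | last g =>
      have w : g ∘L f = (0 : B →L[𝕜] X) ∘L β := by ext a; simpa [ker] using h.1.le ⟨a, rfl⟩
      exact ContinuousLinearMap.ext (Ban.poDesc_inl f β g 0 w)
    | cons g t =>
      have w : g ∘L f = 0 ∘L β := by ext a; simpa [ker] using h.1.le ⟨a, rfl⟩
      exact ⟨ContinuousLinearMap.id 𝕜 _,
        ContinuousLinearMap.ext (Ban.poDesc_inl f β g 0 w), Mor.refl t⟩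

theorem pushout_mor {d : Diagram X (n + 1) A} (h : d.Exact) {α : X →L[𝕜] X'}
    {F : Diagram X' (n + 1) B} (hF : F.Exact) (w : Mor α β d F) :
    Mor α (ContinuousLinearMap.id 𝕜 B) (d.pushout β h) F := by
  cases d with | cons f t =>
  cases F with | cons f' t' =>
  obtain ⟨ψ, h1, h2⟩ := w
  refine ⟨Ban.poDesc f β ψ f' h1.symm, ?_, ?_⟩
  · ext b
    exact (Ban.poDesc_inr f β ψ f' h1.symm b).symm
  · have hk := hF.1.le
    cases t with
    | last g =>
      cases t' with | last g' =>
      ext x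
      obtain ⟨e, b, rfl⟩ := Ban.po_surj f β x
      have h3 : g' (f' b) = 0 := hk ⟨b, rfl⟩
      have h4 : g' (ψ e) = α (g e) := DFunLike.congr_fun h2 e
      simp [h3, h4]
    | cons g t =>
      cases t' with | cons g' t' =>
      obtain ⟨χ, h5, h6⟩ := h2
      refine ⟨χ, ?_, h6⟩
      ext x
      obtain ⟨e, b, rfl⟩ := Ban.po_surj f β x
      have h3 : g' (f' b) = 0 := hk ⟨b, rfl⟩
      have h4 : g' (ψ e) = χ (g e) := DFunLike.congr_fun h5 e
      simp [h3, h4]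

end pushout

section pullback

theorem ker_pullbackCons (α : X' →L[𝕜] X) {E : Ban.{u, v} 𝕜} (f : A →L[𝕜] E)
    (t : Diagram X n E) (h : (cons f t).Exact) :
    (pullbackCons α f t h).ker = (cons f t).ker := by
  cases t with
  | last g =>
    ext x
    constructor
    · exact fun hx => congrArg (Ban.pbFst g α) hx
    · exact fun hx => Ban.pb_ext g α (hx.trans (map_zero _).symm) (map_zero _).symm
  | cons g t => rfl

theorem exact_pullbackCons (α : X' →L[𝕜] X) {E : Ban.{u, v} 𝕜} (f : A →L[𝕜] E)
    (t : Diagram X n E) (h : (cons f t).Exact) : (pullbackCons α f t h).Exact := by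
  induction t generalizing A with
  | last g =>
    refine ⟨?_, ?_⟩
    · ext x
      constructor
      · rintro ⟨a, rfl⟩
        rfl
      · intro hx
        have hx : Ban.pbSnd g α x = 0 := hx
        have h1 : g (Ban.pbFst g α x) = 0 := by rw [Ban.pb_cond, hx, map_zero]
        obtain ⟨a, ha⟩ : Ban.pbFst g α x ∈ f.range := h.1.ge h1
        exact ⟨a, Ban.pb_ext g α ha hx.symm⟩
    · intro x
      obtain ⟨e, he⟩ := h.2 (α x)
      obtain ⟨y, -, hy⟩ := Ban.pb_exists g α e x he
      exact ⟨y, hy⟩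
  | cons g t ih => exact ⟨h.1.trans (ker_pullbackCons α g t h.2).symm, ih _ h.2⟩

theorem ker_pullback (α : X' →L[𝕜] X) (d : Diagram X (n + 1) A) (h : d.Exact) :
    (d.pullback α h).ker = d.ker := by
  cases d with | cons f t => exact ker_pullbackCons α f t h

theorem exact_pullback (α : X' →L[𝕜] X) (d : Diagram X (n + 1) A) (h : d.Exact) :
    (d.pullback α h).Exact := by
  cases d with | cons f t => exact exact_pullbackCons α f t h

theorem pullback_mor (α : X' →L[𝕜] X) (d : Diagram X (n + 1) A) (h : d.Exact) :
    Mor α (ContinuousLinearMap.id 𝕜 A) (d.pullback α h) d := by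
  cases d with | cons f t =>
  change Mor α _ (pullbackCons α f t h) _
  induction t generalizing A with
  | last g =>
    exact ⟨Ban.pbFst g α, rfl, ContinuousLinearMap.ext fun x => Ban.pb_cond g α x⟩
  | cons g t ih => exact ⟨ContinuousLinearMap.id 𝕜 _, rfl, ih g h.2⟩

theorem mor_pullback (α : X' →L[𝕜] X) (d : Diagram X (n + 1) A) (h : d.Exact)
    {φ : A' →L[𝕜] A} {G : Diagram X' (n + 1) A'} (hG : G.Exact) (w : Mor α φ G d) :
    Mor (ContinuousLinearMap.id 𝕜 X') φ G (d.pullback α h) := by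
  cases d with | cons f t =>
  change Mor _ _ _ (pullbackCons α f t h)
  induction t generalizing A A' with
  | last g =>
    cases G with | cons k l =>
    cases l with | last l =>
    obtain ⟨ψ, h1, h2⟩ := w
    refine ⟨Ban.pbLift g α ψ l h2, ?_, rfl⟩
    ext x
    refine Ban.pb_ext g α (DFunLike.congr_fun h1 x) ?_
    have h3 : l (k x) = 0 := hG.1.le ⟨x, rfl⟩
    exact h3.symm
  | cons g t ih =>
    cases G with | cons k l =>
    obtain ⟨ψ, h1, h2⟩ := w
    exact ⟨ψ, h1, ih hG.2 g h.2 h2⟩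

end pullback

section zero

theorem ker_zeroTail (X : Ban.{u, v} 𝕜) (n : ℕ) (A : Ban.{u, v} 𝕜) :
    (zeroTail X n A).ker = ⊤ := by
  cases n <;> exact LinearMap.ker_zero

theorem exact_zeroTail (X : Ban.{u, v} 𝕜) (n : ℕ) (A : Ban.{u, v} 𝕜) :
    (zeroTail X n A).Exact := by
  induction n generalizing A with
  | zero =>
    refine ⟨?_, Function.surjective_id⟩
    exact LinearMap.range_zero.trans LinearMap.ker_id.symm
  | succ n ih =>
    refine ⟨?_, ih _⟩
    rw [ker_zeroTail]
    exact SetLike.ext fun x => ⟨fun _ => trivial, fun _ => ⟨0, rfl⟩⟩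

theorem ker_zero (X : Ban.{u, v} 𝕜) (n : ℕ) (Y : Ban.{u, v} 𝕜) : (zero X n Y).ker = ⊥ := by
  cases n with
  | zero => exact LinearMap.ker_eq_bot.2 LinearMap.inl_injective
  | succ n => exact LinearMap.ker_id

theorem exact_zero (X : Ban.{u, v} 𝕜) (n : ℕ) (Y : Ban.{u, v} 𝕜) : (zero X n Y).Exact := by
  cases n with
  | zero => exact ⟨LinearMap.range_inl 𝕜 Y X, Prod.snd_surjective⟩
  | succ n =>
    exact ⟨LinearMap.range_id.trans (ker_zeroTail X n Y).symm, exact_zeroTail X n Y⟩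

theorem mor_zeroTail {d : Diagram X (n + 1) A} (hd : d.Exact) (B : Ban.{u, v} 𝕜) :
    Mor (ContinuousLinearMap.id 𝕜 X) (0 : A →L[𝕜] B) d (zeroTail X n B) := by
  induction n generalizing A B with
  | zero =>
    cases d with | cons f t =>
    cases t with | last g =>
    refine ⟨g, ?_, rfl⟩
    ext x
    have h3 : g (f x) = 0 := hd.1.le ⟨x, rfl⟩
    exact h3.symm
  | succ n ih =>
    cases d with | cons f t => exact ⟨0, rfl, ih hd.2 _⟩

theorem mor_zero {d : Diagram X (n + 1) A} (hd : d.Exact) (B : Ban.{u, v} 𝕜) :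
    Mor (ContinuousLinearMap.id 𝕜 X) (0 : A →L[𝕜] B) d (zero X n B) := by
  cases n with
  | zero =>
    cases d with | cons f t =>
    cases t with | last g =>
    refine ⟨ContinuousLinearMap.prod 0 g, ?_, rfl⟩
    refine ContinuousLinearMap.ext fun x => ?_
    have h3 : g (f x) = 0 := hd.1.le ⟨x, rfl⟩
    exact Prod.ext rfl h3.symm
  | succ n =>
    cases d with | cons f t =>
    refine ⟨0, ?_, mor_zeroTail hd.2 _⟩
    ext x
    rfl

end zero

end lemmas

end Diagram

/-- An `n`-exact sequence `0 → Y → E₁ → ⋯ → Eₙ → X → 0` between `Y` and `X`. -/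
structure ExactSeq (n : ℕ) (Y X : Ban.{u, v} 𝕜) where
  /-- the underlying diagram `Y → E₁ → ⋯ → Eₙ → X` -/
  diagram : Diagram X n Y
  ker_eq_bot : diagram.ker = ⊥
  exact : diagram.Exact

namespace ExactSeq

variable {n m : ℕ} {X X' Y Y' Z : Ban.{u, v} 𝕜}

/-- `E.Hom F`: there is a morphism from `E` to `F` which is the identity on both ends. -/
def Hom (E F : ExactSeq n Y X) : Prop :=
  Diagram.Mor (ContinuousLinearMap.id 𝕜 X) (ContinuousLinearMap.id 𝕜 Y) E.diagram F.diagram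

/-- The pushout sequence `βE`. -/
def pushout (β : Y →L[𝕜] Y') (E : ExactSeq (n + 1) Y X) : ExactSeq (n + 1) Y' X :=
  ⟨E.diagram.pushout β E.exact, Diagram.ker_pushout β E.exact E.ker_eq_bot,
    Diagram.exact_pushout β E.exact⟩

/-- The pullback sequence `Eα`. -/
def pullback (α : X' →L[𝕜] X) (E : ExactSeq (n + 1) Y X) : ExactSeq (n + 1) Y X' :=
  ⟨E.diagram.pullback α E.exact, (Diagram.ker_pullback α _ E.exact).trans E.ker_eq_bot,
    Diagram.exact_pullback α _ E.exact⟩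

/-- The direct sum of two exact sequences. -/
def prod (E : ExactSeq n Y X) (F : ExactSeq n Y' X') : ExactSeq n (Y.prod Y') (X.prod X') :=
  ⟨E.diagram.prod F.diagram, by
    rw [Diagram.ker_prod, E.ker_eq_bot, F.ker_eq_bot]; exact Submodule.prod_bot, E.exact.prod F.exact⟩

/-- The splicing `EF` of two exact sequences through `Z`. -/
def splice (E : ExactSeq n Y Z) (F : ExactSeq m Z X) : ExactSeq (m + n) Y X :=
  ⟨E.diagram.splice F.diagram, (Diagram.ker_splice _ F.ker_eq_bot).trans E.ker_eq_bot,
    E.exact.splice F.exact F.ker_eq_bot⟩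

/-- The zero sequence. -/
def zero (n : ℕ) (Y X : Ban.{u, v} 𝕜) : ExactSeq (n + 1) Y X :=
  ⟨Diagram.zero X n Y, Diagram.ker_zero X n Y, Diagram.exact_zero X n Y⟩

end ExactSeq

/-! ### The spaces `Extⁿ(X, Y)` -/

/-- `Extⁿ(X, Y)`, for `n ≥ 1`: the `n`-exact sequences between `Y` and `X`, modulo the equivalence
relation generated by the existence of a morphism which is the identity on both ends. -/
def Ext (n : ℕ) (X Y : Ban.{u, v} 𝕜) : Type (max (u + 1) v) :=
  Quot (ExactSeq.Hom : ExactSeq n Y X → ExactSeq n Y X → Prop)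

namespace Ext

variable {n m : ℕ} {X X' X'' Y Y' Y'' Z : Ban.{u, v} 𝕜}

/-- The class of an exact sequence. -/
def mk (E : ExactSeq n Y X) : Ext n X Y := Quot.mk _ E

theorem mk_eq_of_hom {E F : ExactSeq n Y X} (h : E.Hom F) : mk E = mk F := Quot.sound h

theorem pushout_mk_eq_pullback_mk {α : X →L[𝕜] X'} {β : Y →L[𝕜] Y'} {E : ExactSeq (n + 1) Y X}
    {F : ExactSeq (n + 1) Y' X'} (h : Diagram.Mor α β E.diagram F.diagram) :
    mk (E.pushout β) = mk (F.pullback α) :=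
  mk_eq_of_hom (Diagram.mor_pullback α _ F.exact (E.pushout β).exact
    (Diagram.pushout_mor β E.exact F.exact h))

theorem pushout_mk_eq {β : Y →L[𝕜] Y'} {E : ExactSeq (n + 1) Y X} {F : ExactSeq (n + 1) Y' X}
    (h : Diagram.Mor (ContinuousLinearMap.id 𝕜 X) β E.diagram F.diagram) :
    mk (E.pushout β) = mk F :=
  mk_eq_of_hom (Diagram.pushout_mor β E.exact F.exact h)

theorem pullback_mk_eq {α : X' →L[𝕜] X} {E : ExactSeq (n + 1) Y X} {F : ExactSeq (n + 1) Y X'}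
    (h : Diagram.Mor α (ContinuousLinearMap.id 𝕜 Y) F.diagram E.diagram) :
    mk (E.pullback α) = mk F :=
  (mk_eq_of_hom (F := E.pullback α) (Diagram.mor_pullback α _ E.exact F.exact h)).symm

/-- The pushout of classes along `β`. -/
def push (β : Y →L[𝕜] Y') : Ext (n + 1) X Y → Ext (n + 1) X Y' :=
  Quot.lift (fun E => mk (E.pushout β)) fun E F (h : E.Hom F) =>
    pushout_mk_eq (F := F.pushout β) (Diagram.Mor.comp h (Diagram.mor_pushout β F.exact))

/-- The pullback of classes along `α`. -/
def pull (α : X' →L[𝕜] X) : Ext (n + 1) X Y → Ext (n + 1) X' Y :=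
  Quot.lift (fun E => mk (E.pullback α)) fun E F (h : E.Hom F) =>
    (pullback_mk_eq (F := E.pullback α)
      (Diagram.Mor.comp (Diagram.pullback_mor α _ E.exact) h)).symm

/-- The direct sum of classes. -/
def sum : Ext n X Y → Ext n X' Y' → Ext n (X.prod X') (Y.prod Y') :=
  Quot.map₂ ExactSeq.prod
    (fun E _ _ h => Diagram.Mor.prod (Diagram.Mor.refl E.diagram) h)
    (fun _ _ F h => Diagram.Mor.prod h (Diagram.Mor.refl F.diagram))

/-- The map `[F] ↦ [EF]` given by splicing with `E` on the left. -/
def splice (E : ExactSeq n Y Z) : Ext m X Z → Ext (m + n) X Y :=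
  Quot.map E.splice fun _ _ h => Diagram.Mor.splice (Diagram.Mor.refl E.diagram) h

/-- The diagonal operator `x ↦ (x, x)`. -/
def diag (X : Ban.{u, v} 𝕜) : X →L[𝕜] X.prod X :=
  (ContinuousLinearMap.id 𝕜 X).prod (ContinuousLinearMap.id 𝕜 X)

/-- The codiagonal operator `(y, y') ↦ y + y'`. -/
def codiag (Y : Ban.{u, v} 𝕜) : Y.prod Y →L[𝕜] Y :=
  (ContinuousLinearMap.id 𝕜 Y).coprod (ContinuousLinearMap.id 𝕜 Y)

/-- The Baer sum: the pushout along the codiagonal of the pullback along the diagonal of the direct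
sum. -/
instance : Add (Ext (n + 1) X Y) := ⟨fun x y => push (codiag Y) (pull (diag X) (sum x y))⟩

/-- Scalar multiplication: the pushout along the homothety `y ↦ c • y`. -/
instance : SMul 𝕜 (Ext (n + 1) X Y) := ⟨fun c => push (c • ContinuousLinearMap.id 𝕜 Y)⟩

instance : Zero (Ext (n + 1) X Y) := ⟨mk (ExactSeq.zero n Y X)⟩

instance : Neg (Ext (n + 1) X Y) := ⟨push (-ContinuousLinearMap.id 𝕜 Y)⟩

theorem add_def (x y : Ext (n + 1) X Y) :
    x + y = push (codiag Y) (pull (diag X) (sum x y)) := rfl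

theorem smul_def (c : 𝕜) (x : Ext (n + 1) X Y) :
    c • x = push (c • ContinuousLinearMap.id 𝕜 Y) x := rfl

theorem neg_def (x : Ext (n + 1) X Y) : -x = push (-ContinuousLinearMap.id 𝕜 Y) x := rfl

theorem push_push (β : Y →L[𝕜] Y') (β' : Y' →L[𝕜] Y'') (x : Ext (n + 1) X Y) :
    push β' (push β x) = push (β' ∘L β) x := by
  obtain ⟨E, rfl⟩ := Quot.exists_rep x
  exact (pushout_mk_eq (F := (E.pushout β).pushout β') (Diagram.Mor.comp
    (Diagram.mor_pushout β E.exact) (Diagram.mor_pushout β' (E.pushout β).exact))).symm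

theorem pull_pull (α : X' →L[𝕜] X) (α' : X'' →L[𝕜] X') (x : Ext (n + 1) X Y) :
    pull α' (pull α x) = pull (α ∘L α') x := by
  obtain ⟨E, rfl⟩ := Quot.exists_rep x
  exact (pullback_mk_eq (F := (E.pullback α).pullback α') (Diagram.Mor.comp
    (Diagram.pullback_mor α' _ (E.pullback α).exact) (Diagram.pullback_mor α _ E.exact))).symm

theorem push_id (x : Ext (n + 1) X Y) : push (ContinuousLinearMap.id 𝕜 Y) x = x := by
  obtain ⟨E, rfl⟩ := Quot.exists_rep x
  exact pushout_mk_eq (Diagram.Mor.refl _)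

theorem pull_id (x : Ext (n + 1) X Y) : pull (ContinuousLinearMap.id 𝕜 X) x = x := by
  obtain ⟨E, rfl⟩ := Quot.exists_rep x
  exact pullback_mk_eq (Diagram.Mor.refl _)

theorem push_pull (β : Y →L[𝕜] Y') (α : X' →L[𝕜] X) (x : Ext (n + 1) X Y) :
    push β (pull α x) = pull α (push β x) := by
  obtain ⟨E, rfl⟩ := Quot.exists_rep x
  exact pushout_mk_eq_pullback_mk (Diagram.Mor.comp (Diagram.pullback_mor α _ E.exact)
    (Diagram.mor_pushout β E.exact))

theorem push_prod_sum {Z Z' : Ban.{u, v} 𝕜} (β : Y →L[𝕜] Z) (β' : Y' →L[𝕜] Z')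
    (x : Ext (n + 1) X Y) (y : Ext (n + 1) X' Y') :
    push (Y := Y.prod Y') (Y' := Z.prod Z') (β.prodMap β') (sum x y) =
      sum (push β x) (push β' y) := by
  obtain ⟨E, rfl⟩ := Quot.exists_rep x
  obtain ⟨F, rfl⟩ := Quot.exists_rep y
  have h := Diagram.Mor.prod (Diagram.mor_pushout β E.exact) (Diagram.mor_pushout β' F.exact)
  exact pushout_mk_eq (E := E.prod F) (F := (E.pushout β).prod (F.pushout β')) h

theorem pull_prod_sum {Z Z' : Ban.{u, v} 𝕜} (α : Z →L[𝕜] X) (α' : Z' →L[𝕜] X')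
    (x : Ext (n + 1) X Y) (y : Ext (n + 1) X' Y') :
    pull (X := X.prod X') (X' := Z.prod Z') (α.prodMap α') (sum x y) =
      sum (pull α x) (pull α' y) := by
  obtain ⟨E, rfl⟩ := Quot.exists_rep x
  obtain ⟨F, rfl⟩ := Quot.exists_rep y
  have h := Diagram.Mor.prod (Diagram.pullback_mor α _ E.exact) (Diagram.pullback_mor α' _ F.exact)
  exact pullback_mk_eq (E := E.prod F) (F := (E.pullback α).prod (F.pullback α')) h

theorem push_swap (x : Ext (n + 1) X Y) (y : Ext (n + 1) X' Y') :
    push (Y := Y.prod Y') (Y' := Y'.prod Y) (ContinuousLinearEquiv.prodComm 𝕜 Y Y') (sum x y) =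
      pull (X := X'.prod X) (X' := X.prod X') (ContinuousLinearEquiv.prodComm 𝕜 X X')
        (sum y x) := by
  obtain ⟨E, rfl⟩ := Quot.exists_rep x
  obtain ⟨F, rfl⟩ := Quot.exists_rep y
  exact pushout_mk_eq_pullback_mk (E := E.prod F) (F := F.prod E) (Diagram.Mor.swap _ _)

theorem push_assoc (x : Ext (n + 1) X Y) (y : Ext (n + 1) X' Y') (z : Ext (n + 1) X'' Y'') :
    push (Y := (Y.prod Y').prod Y'') (Y' := Y.prod (Y'.prod Y''))
        (ContinuousLinearEquiv.prodAssoc 𝕜 Y Y' Y'') (sum (sum x y) z) =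
      pull (X := X.prod (X'.prod X'')) (X' := (X.prod X').prod X'')
        (ContinuousLinearEquiv.prodAssoc 𝕜 X X' X'') (sum x (sum y z)) := by
  obtain ⟨E, rfl⟩ := Quot.exists_rep x
  obtain ⟨F, rfl⟩ := Quot.exists_rep y
  obtain ⟨G, rfl⟩ := Quot.exists_rep z
  exact pushout_mk_eq_pullback_mk (E := (E.prod F).prod G) (F := E.prod (F.prod G))
    (Diagram.Mor.assoc _ _ _)

theorem push_diag (x : Ext (n + 1) X Y) : push (diag Y) x = pull (diag X) (sum x x) := by
  obtain ⟨E, rfl⟩ := Quot.exists_rep x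
  exact pushout_mk_eq_pullback_mk (F := E.prod E) (Diagram.Mor.diag _)

theorem push_zero (x : Ext (n + 1) X Y) : push (0 : Y →L[𝕜] Y') x = 0 := by
  obtain ⟨E, rfl⟩ := Quot.exists_rep x
  exact pushout_mk_eq (F := ExactSeq.zero n Y' X) (Diagram.mor_zero E.exact Y')

theorem push_add (β : Y →L[𝕜] Y') (x y : Ext (n + 1) X Y) :
    push β (x + y) = push β x + push β y := by
  rw [add_def, add_def, ← push_prod_sum, ← push_pull, push_push, push_push]
  congr 1
  ext z <;> simp [codiag]

theorem add_push (β γ : Y →L[𝕜] Y') (x : Ext (n + 1) X Y) :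
    push (β + γ) x = push β x + push γ x := by
  rw [add_def, ← push_prod_sum, ← push_pull, ← push_diag, push_push, push_push]
  rfl

theorem add_comm' (x y : Ext (n + 1) X Y) : x + y = y + x := by
  have h1 : codiag Y = (codiag Y) ∘L
      (ContinuousLinearEquiv.prodComm 𝕜 Y Y : Y.prod Y →L[𝕜] Y.prod Y) := by
    ext z <;> simp [codiag]
  rw [add_def, push_pull, h1, ← push_push, push_swap, push_pull, pull_pull, ← push_pull, add_def]
  rfl

theorem zero_add' (x : Ext (n + 1) X Y) : 0 + x = x := by
  calc 0 + x = push (0 : Y →L[𝕜] Y) x + push (ContinuousLinearMap.id 𝕜 Y) x := by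
        rw [push_zero, push_id]
    _ = x := by rw [← add_push, zero_add, push_id]

theorem sum_push_left (β : Y →L[𝕜] Y'') (x : Ext (n + 1) X Y) (y : Ext (n + 1) X' Y') :
    sum (push β x) y = push (Y := Y.prod Y') (Y' := Y''.prod Y')
      (β.prodMap (ContinuousLinearMap.id 𝕜 Y')) (sum x y) := by
  rw [push_prod_sum, push_id]

theorem sum_push_right (β : Y' →L[𝕜] Y'') (x : Ext (n + 1) X Y) (y : Ext (n + 1) X' Y') :
    sum x (push β y) = push (Y := Y.prod Y') (Y' := Y.prod Y'')
      ((ContinuousLinearMap.id 𝕜 Y).prodMap β) (sum x y) := by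
  rw [push_prod_sum, push_id]

theorem sum_pull_left (α : X'' →L[𝕜] X) (x : Ext (n + 1) X Y) (y : Ext (n + 1) X' Y') :
    sum (pull α x) y = pull (X := X.prod X') (X' := X''.prod X')
      (α.prodMap (ContinuousLinearMap.id 𝕜 X')) (sum x y) := by
  rw [pull_prod_sum, pull_id]

theorem sum_pull_right (α : X'' →L[𝕜] X') (x : Ext (n + 1) X Y) (y : Ext (n + 1) X' Y') :
    sum x (pull α y) = pull (X := X.prod X') (X' := X.prod X'')
      ((ContinuousLinearMap.id 𝕜 X).prodMap α) (sum x y) := by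
  rw [pull_prod_sum, pull_id]

theorem add_assoc' (x y z : Ext (n + 1) X Y) : x + y + z = x + (y + z) := by
  have hY : (codiag Y) ∘L ((codiag Y).prodMap (ContinuousLinearMap.id 𝕜 Y)) =
      ((codiag Y) ∘L ((ContinuousLinearMap.id 𝕜 Y).prodMap (codiag Y))) ∘L
        (ContinuousLinearEquiv.prodAssoc 𝕜 Y Y Y :
          (Y.prod Y).prod Y →L[𝕜] Y.prod (Y.prod Y)) := by
    refine ContinuousLinearMap.ext fun v => ?_
    exact add_assoc v.1.1 v.1.2 v.2
  have h := congrArg (push ((codiag Y) ∘L ((ContinuousLinearMap.id 𝕜 Y).prodMap (codiag Y))))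
    (push_assoc x y z)
  rw [push_push] at h
  rw [add_def (x + y), add_def x y, add_def x (y + z), add_def y z, sum_push_left, sum_pull_left,
    sum_push_right, sum_pull_right, ← push_pull, push_push, pull_pull, ← push_pull, push_push,
    pull_pull, hY, push_pull, h, push_pull, pull_pull, ← push_pull]
  rfl

instance : AddCommGroup (Ext (n + 1) X Y) where
  add_assoc := add_assoc'
  add_comm := add_comm'
  zero_add := zero_add'
  add_zero x := (add_comm' x 0).trans (zero_add' x)
  neg_add_cancel x := by
    calc -x + x = push (-ContinuousLinearMap.id 𝕜 Y) x + push (ContinuousLinearMap.id 𝕜 Y) x := by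
          rw [push_id, neg_def]
      _ = 0 := by rw [← add_push, neg_add_cancel, push_zero]
  nsmul := nsmulRec
  zsmul := zsmulRec

instance : Module 𝕜 (Ext (n + 1) X Y) where
  one_smul x := by rw [smul_def, one_smul, push_id]
  mul_smul a b x := by
    rw [smul_def, smul_def, smul_def, push_push]
    congr 1
    ext z
    simp [mul_smul, smul_comm a b]
  smul_zero a := by
    rw [smul_def, ← push_zero (0 : Ext (n + 1) X Y), push_push, ContinuousLinearMap.comp_zero]
  zero_smul x := by rw [smul_def, zero_smul, push_zero]
  smul_add a x y := push_add _ x y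
  add_smul a b x := by rw [smul_def, add_smul, add_push]; rfl

end Ext

/-! ### Injective presentations -/

/-- An injective presentation of `Y`: a short exact sequence `0 → Y → I → cκ(Y) → 0` of Banach
spaces in which `I` is injective. -/
structure InjPresentation (Y : Ban.{u, v} 𝕜) where
  /-- the injective space `I` -/
  I : Ban.{u, v} 𝕜
  /-- the space `cκ(Y)`, isomorphic to `I / ι[Y]` -/
  coker : Ban.{u, v} 𝕜
  /-- the operator `Y → I` -/
  ι : Y →L[𝕜] I
  /-- the operator `I → cκ(Y)` -/
  π : I →L[𝕜] coker
  ι_injective : Function.Injective ι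
  range_eq_ker : ι.range = π.ker
  π_surjective : Function.Surjective π
  isInjective : I.IsInjective

/-- An injective presentation as an exact sequence of length one. -/
def InjPresentation.toExactSeq {Y : Ban.{u, v} 𝕜} (P : InjPresentation Y) :
    ExactSeq 1 Y P.coker :=
  ⟨.cons P.ι (.last P.π), LinearMap.ker_eq_bot.2 P.ι_injective, P.range_eq_ker, P.π_surjective⟩

/-- `cκᵏ(Y)`, for a fixed choice `P` of an injective presentation of each Banach space:
`cκ⁰(Y) = Y` and `cκᵏ⁺¹(Y) = cκ(cκᵏ(Y))`. -/
def cokerPow (P : (Y : Ban.{u, v} 𝕜) → InjPresentation Y) : ℕ → Ban.{u, v} 𝕜 → Ban.{u, v} 𝕜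
  | 0, Y => Y
  | k + 1, Y => (P (cokerPow P k Y)).coker

/-- The subspace `π_*[𝔏(X, I)]` of those operators `X → C` that lift to `I` through `π : I → C`. -/
def liftable (X : Ban.{u, v} 𝕜) {I C : Ban.{u, v} 𝕜} (π : I →L[𝕜] C) : Submodule 𝕜 (X →L[𝕜] C) :=
  (ContinuousLinearMap.compL 𝕜 X I C π).range

end BanachExt
end

open BanachExt

noncomputable section

namespace BanachExt

variable {𝕜 : Type v} [RCLike 𝕜]

/-! The proof is dimension shifting carried out by hand on exact sequences. A sequence `E` of length
at least two is cut into `s d`, with `s : 0 → Y → E₁ → Z → 0` short exact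
(`ExactSeq.exists_eq_splice`). Injectivity of `I` extends `ι : Y → I` to `E₁`, and passing to
quotients gives `γ : Z → cκ(Y)` together with a morphism from `s` to the presentation that is the
identity on `Y` (`exists_mor`). The inverse of splicing sends `[E]` to the pushout `γ[d]`.

The class `γ[d]` does not depend on the choices. Two such `γ` differ by an operator that lifts
through `π` (`sub_mem_liftable`), so their pushouts differ by a class coming from `Ext(X, I)`, which
is zero (`eq_zero_of_isInjective`). A morphism of spliced sequences induces an operator between the
spaces `Z` (`exists_mor_of_hom_splice`), which gives invariance under the equivalence relation.
Splicing `γ[d]` with the presentation returns `[E]`, because a morphism of short exact sequences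
moves pushouts across a splice (`push_splice`); the same lemma makes splicing linear.

In length one, `γ` itself, taken modulo liftable operators, classifies the sequence: `exists_mor`
gives surjectivity of the connecting map and `sub_mem_liftable` identifies its kernel. -/

/-- An operator vanishing on the kernel of a surjective operator between Banach spaces factors
through it. -/
theorem Ban.exists_factor {E Z W : Ban.{u, v} 𝕜} (p : E →L[𝕜] Z) (hp : Function.Surjective p)
    (q : E →L[𝕜] W) (h : ∀ x, p x = 0 → q x = 0) : ∃ χ : Z →L[𝕜] W, ∀ x, χ (p x) = q x := by
  have hk : (p : E →ₗ[𝕜] Z).ker ≤ (q : E →ₗ[𝕜] W).ker := fun x hx => h x hx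
  let L : Z →ₗ[𝕜] W := ((p : E →ₗ[𝕜] Z).ker.liftQ (q : E →ₗ[𝕜] W) hk) ∘ₗ
    ((p : E →ₗ[𝕜] Z).quotKerEquivOfSurjective hp).symm.toLinearMap
  have hL : ∀ x, L (p x) = q x := fun x => by
    have : ((p : E →ₗ[𝕜] Z).quotKerEquivOfSurjective hp).symm (p x) = Submodule.Quotient.mk x := by
      rw [LinearEquiv.symm_apply_eq]
      rfl
    simp only [L, LinearMap.comp_apply, LinearEquiv.coe_coe, this]
    rfl
  refine ⟨⟨L, ?_⟩, hL⟩
  -- By the open mapping theorem `p` is a topological quotient map, so continuity of `L` can be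
  -- tested on `L ∘ p = q`.
  refine ((p.isQuotientMap hp).continuous_iff).2 ?_
  exact q.continuous.congr fun x => (hL x).symm

theorem Ban.comp_smul_id {A B : Ban.{u, v} 𝕜} (c : 𝕜) (f : A →L[𝕜] B) :
    f ∘L (c • ContinuousLinearMap.id 𝕜 A) = (c • ContinuousLinearMap.id 𝕜 B) ∘L f := by
  ext x
  exact map_smul f c x

/-! ### Endomorphisms, direct sums and cancellation for diagrams. -/

namespace Diagram

variable {X X' A A' : Ban.{u, v} 𝕜} {n m : ℕ}

theorem Mor.codiag (d : Diagram X n A) :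
    Mor (X := X.prod X) (A := A.prod A) (Ext.codiag X) (Ext.codiag A) (d.prod d) d := by
  induction d with
  | last f => exact ContinuousLinearMap.ext fun x => map_add f x.1 x.2
  | cons f t ih => exact ⟨Ext.codiag _, ContinuousLinearMap.ext fun x => map_add f x.1 x.2, ih⟩

theorem Mor.smul (c : 𝕜) (d : Diagram X n A) :
    Mor (c • ContinuousLinearMap.id 𝕜 X) (c • ContinuousLinearMap.id 𝕜 A) d d := by
  induction d with
  | last f => exact Ban.comp_smul_id c f
  | cons f t ih => exact ⟨_, Ban.comp_smul_id c f, ih⟩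

theorem precomp_prod {B B' : Ban.{u, v} 𝕜} (d : Diagram X n A) (d' : Diagram X' n A')
    (p : B →L[𝕜] A) (p' : B' →L[𝕜] A') :
    (d.prod d').precomp (B := B.prod B') (p.prodMap p') =
      (d.precomp p).prod (d'.precomp p') := by
  cases d <;> cases d' <;> rfl

theorem splice_prod {Z Z' : Ban.{u, v} 𝕜} (s : Diagram Z n A) (s' : Diagram Z' n A')
    (d : Diagram X m Z) (d' : Diagram X' m Z') :
    (s.prod s').splice (d.prod d') = (s.splice d).prod (s'.splice d') := by
  induction s generalizing A' with
  | last p => cases s' with | last p' => exact precomp_prod d d' p p'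
  | cons f t ih =>
    cases s' with | cons f' t' => exact congrArg (cons _) (ih t')

/-- Precomposition alters only the first arrow, so only the first square has to be checked, and
there the surjection `p` can be cancelled on the right. -/
theorem mor_of_precomp {B B' : Ban.{u, v} 𝕜} {α : X →L[𝕜] X'} {d : Diagram X n A}
    {d' : Diagram X' n A'} {p : B →L[𝕜] A} {p' : B' →L[𝕜] A'} {ψ : B →L[𝕜] B'}
    {χ : A →L[𝕜] A'} (hp : Function.Surjective p) (w : χ ∘L p = p' ∘L ψ)
    (h : Mor α ψ (d.precomp p) (d'.precomp p')) : Mor α χ d d' := by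
  cases d with
  | last f =>
    cases d' with | last f' =>
    ext x
    obtain ⟨y, rfl⟩ := hp x
    exact (congrArg f' (DFunLike.congr_fun w y)).trans (DFunLike.congr_fun h y)
  | cons f t =>
    cases d' with | cons f' t' =>
    obtain ⟨φ, h1, h2⟩ := h
    refine ⟨φ, ?_, h2⟩
    ext x
    obtain ⟨y, rfl⟩ := hp x
    exact (congrArg f' (DFunLike.congr_fun w y)).trans (DFunLike.congr_fun h1 y)

end Diagram

/-! ### Cutting exact sequences and their morphisms. -/

namespace ExactSeq

variable {n m : ℕ} {X X' Y Y' Z Z' : Ban.{u, v} 𝕜}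

theorem ext_diagram {E F : ExactSeq n Y X} (h : E.diagram = F.diagram) : E = F := by
  cases E
  cases F
  cases h
  rfl

theorem splice_prod (s : ExactSeq n Y Z) (s' : ExactSeq n Y' Z') (d : ExactSeq m Z X)
    (d' : ExactSeq m Z' X') :
    (s.prod s').splice (d.prod d') = (s.splice d).prod (s'.splice d') :=
  ext_diagram (Diagram.splice_prod _ _ _ _)

/-- An exact sequence of length at least two is the splicing of a short exact sequence with an
exact sequence. -/
theorem exists_eq_splice (E : ExactSeq (n + 2) Y X) :
    ∃ (Z : Ban.{u, v} 𝕜) (s : ExactSeq 1 Y Z) (d : ExactSeq (n + 1) Z X), E = s.splice d := by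
  obtain ⟨E, hk, he⟩ := E
  cases E with | cons f t =>
  cases t with | cons g t =>
  obtain ⟨h1, h2, h3⟩ := he
  -- The cut is made at `ker t`, which is the image of the second arrow `g`; being closed, it is a
  -- Banach space.
  let Z : Ban.{u, v} 𝕜 := @Ban.mk 𝕜 _ t.ker _ _ (Diagram.isClosed_ker t).completeSpace_coe
  let p := g.codRestrict t.ker fun x => h2.le ⟨x, rfl⟩
  let j : Z →L[𝕜] _ := t.ker.subtypeL
  have hg : g = j ∘L p := ContinuousLinearMap.ext fun _ => rfl
  refine ⟨Z, ⟨.cons f (.last p), hk, ?_, ?_⟩, ⟨.cons j t, ?_, ?_, h3⟩, ext_diagram ?_⟩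
  · rw [h1]
    ext x
    exact (Subtype.ext_iff (a1 := p x) (a2 := 0)).symm
  · rintro ⟨x, hx⟩
    obtain ⟨y, rfl⟩ := h2.ge hx
    exact ⟨y, rfl⟩
  · exact Submodule.ker_subtype _
  · exact Submodule.range_subtype _
  · exact congrArg (fun g => Diagram.cons f (Diagram.cons g t)) hg

/-- A morphism between spliced sequences splits into morphisms of the factors. -/
theorem exists_mor_of_hom_splice {s : ExactSeq 1 Y Z} {s' : ExactSeq 1 Y Z'} {d : ExactSeq m Z X}
    {d' : ExactSeq m Z' X} (h : (s.splice d).Hom (s'.splice d')) :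
    ∃ χ : Z →L[𝕜] Z',
      Diagram.Mor χ (ContinuousLinearMap.id 𝕜 Y) s.diagram s'.diagram ∧
      Diagram.Mor (ContinuousLinearMap.id 𝕜 X) χ d.diagram d'.diagram := by
  obtain ⟨s, hk, hs⟩ := s
  obtain ⟨s', hk', hs'⟩ := s'
  cases s with | cons f t =>
  cases t with | last p =>
  cases s' with | cons f' t' =>
  cases t' with | last p' =>
  obtain ⟨ψ, h1, h2⟩ := h
  -- `ker p` is the image of `f`, and `p' ψ f = p' f' = 0`.
  obtain ⟨χ, hχ⟩ := Ban.exists_factor p hs.2 (p' ∘L ψ) fun x hx => by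
    obtain ⟨y, rfl⟩ := hs.1.ge hx
    have h3 : f' y = ψ (f y) := DFunLike.congr_fun h1 y
    exact (congrArg p' h3).symm.trans (hs'.1.le ⟨y, rfl⟩)
  have hχ : χ ∘L p = p' ∘L ψ := ContinuousLinearMap.ext hχ
  exact ⟨χ, ⟨ψ, h1, hχ.symm⟩, Diagram.mor_of_precomp hs.2 hχ h2⟩

end ExactSeq

/-! ### Linearity of pullback and of splicing; vanishing of `Ext` into injective spaces. -/

namespace Ext

variable {n m : ℕ} {X X' Y Y' Z Z' : Ban.{u, v} 𝕜}

theorem pull_codiag (x : Ext (n + 1) X Y) : pull (codiag X) x = push (codiag Y) (sum x x) := by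
  obtain ⟨E, rfl⟩ := Quot.exists_rep x
  exact (pushout_mk_eq_pullback_mk (E := E.prod E) (Diagram.Mor.codiag _)).symm

/-- Dual to `add_push`: `a + b` is the composition of the diagonal, `a × b` and the codiagonal, and
`pull_codiag` trades the codiagonal of `X` for that of `Y`. -/
theorem add_pull (a b : X' →L[𝕜] X) (x : Ext (n + 1) X Y) :
    pull (a + b) x = pull a x + pull b x := by
  rw [add_def, ← pull_prod_sum, pull_pull, push_pull, ← pull_codiag, pull_pull]
  rfl

theorem smul_pull (c : 𝕜) (a : X' →L[𝕜] X) (x : Ext (n + 1) X Y) :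
    pull (c • a) x = c • pull a x := by
  rw [smul_def, push_pull]
  -- Multiplication by `c` on every term is an endomorphism of the sequence, so acting on `Y` or on
  -- `X` gives the same class.
  have h : push (c • ContinuousLinearMap.id 𝕜 Y) x = pull (c • ContinuousLinearMap.id 𝕜 X) x := by
    obtain ⟨E, rfl⟩ := Quot.exists_rep x
    exact pushout_mk_eq_pullback_mk (Diagram.Mor.smul c _)
  rw [h, pull_pull]
  rfl

theorem push_map_zero (β : Y →L[𝕜] Y') : push β (0 : Ext (n + 1) X Y) = 0 := by
  rw [← push_zero (0 : Ext (n + 1) X Y), push_push, ContinuousLinearMap.comp_zero, push_zero]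

/-- Splicing `h` with the canonical morphism from `d` to `γd` gives a morphism from `sd` to `s'(γd)`
that is `φ` on the left and the identity on `X`; the universal property of the pushout concludes.
Codiagonals and homotheties give linearity of splicing, while `φ = id` gives the dimension shift. -/
theorem push_splice {s : ExactSeq 1 Y Z} {s' : ExactSeq 1 Y' Z'} {γ : Z →L[𝕜] Z'}
    {φ : Y →L[𝕜] Y'} (h : Diagram.Mor γ φ s.diagram s'.diagram) (x : Ext (n + 1) X Z) :
    push (n := n + 1) φ (splice s x) = splice s' (push γ x) := by
  obtain ⟨d, rfl⟩ := Quot.exists_rep x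
  exact pushout_mk_eq (E := s.splice d) (F := s'.splice (d.pushout γ))
    (Diagram.Mor.splice h (Diagram.mor_pushout γ d.exact))

theorem pull_splice (s : ExactSeq 1 Y Z) (α : X' →L[𝕜] X) (x : Ext (n + 1) X Z) :
    pull (n := n + 1) α (splice s x) = splice s (pull α x) := by
  obtain ⟨d, rfl⟩ := Quot.exists_rep x
  exact pullback_mk_eq (E := s.splice d) (F := s.splice (d.pullback α))
    (Diagram.Mor.splice (Diagram.Mor.refl s.diagram) (Diagram.pullback_mor α _ d.exact))

/-- Direct sum and splicing commute as diagrams, not merely up to equivalence. -/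
theorem sum_splice (s : ExactSeq 1 Y Z) (s' : ExactSeq 1 Y' Z') (x : Ext (n + 1) X Z)
    (y : Ext (n + 1) X' Z') :
    sum (splice s x) (splice s' y) = splice (s.prod s') (sum x y) := by
  obtain ⟨d, rfl⟩ := Quot.exists_rep x
  obtain ⟨e, rfl⟩ := Quot.exists_rep y
  exact congrArg mk (ExactSeq.splice_prod s s' d e).symm

/-- Splicing with a short exact sequence on the left, as a linear map. -/
def spliceₗ (s : ExactSeq 1 Y Z) : Ext (n + 1) X Z →ₗ[𝕜] Ext (n + 2) X Y where
  toFun := splice s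
  map_add' x y := by
    have h : push (n := n + 1) (codiag Y) (splice (s.prod s) (pull (diag X) (sum x y))) =
        splice s (push (codiag Z) (pull (diag X) (sum x y))) :=
      push_splice (Diagram.Mor.codiag s.diagram) _
    -- The direct sum, the diagonal pullback and the codiagonal pushout that make up the Baer sum
    -- are moved across the splice one at a time.
    exact h.symm.trans (congrArg (push (codiag Y))
      ((pull_splice (s.prod s) (diag X) _).symm.trans (congrArg _ (sum_splice s s x y).symm)))
  map_smul' c x := (push_splice (Diagram.Mor.smul c s.diagram) x).symm

/-- There are no nontrivial exact sequences starting in an injective space. -/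
theorem eq_zero_of_isInjective {I : Ban.{u, v} 𝕜} (hI : I.IsInjective) (x : Ext (n + 1) X I) :
    x = 0 := by
  obtain ⟨E, rfl⟩ := Quot.exists_rep x
  refine mk_eq_of_hom (F := ExactSeq.zero n I X) ?_
  obtain ⟨E, hk, he⟩ := E
  cases E with | cons f t =>
  -- `T` is a retraction of `f`: the identity of `I` extended along the closed embedding `f`.
  obtain ⟨T, hT⟩ := hI _ _ f (LinearMap.ker_eq_bot.1 hk)
    (by have := t.isClosed_ker; rwa [← he.1] at this) (ContinuousLinearMap.id 𝕜 I)
  cases n with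
  | zero =>
    cases t with | last g =>
    refine ⟨T.prod g, ContinuousLinearMap.ext fun x => ?_, rfl⟩
    have h3 : g (f x) = 0 := he.1.le ⟨x, rfl⟩
    exact Prod.ext (DFunLike.congr_fun hT x).symm h3.symm
  | succ n =>
    refine ⟨T, hT.symm, ?_⟩
    -- With `T` as first vertical arrow, `mor_zeroTail` is not applicable yet, since it needs a zero
    -- arrow on the left. With exactly two middle terms the next arrow is the last map `k` into `X`;
    -- with more, it is `0` into the zero space, and `mor_zeroTail` takes over from there.
    cases n with
    | zero =>
      cases t with | cons g t =>
      cases t with | last k =>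
      refine ⟨k, ContinuousLinearMap.ext fun x => ?_, rfl⟩
      have h3 : k (g x) = 0 := he.2.1.le ⟨x, rfl⟩
      exact h3.symm
    | succ n =>
      cases t with | cons g t =>
      exact ⟨0, rfl, Diagram.mor_zeroTail he.2.2 _⟩

end Ext

/-! ### Comparison with the injective presentation and the dimension shift. -/

namespace InjPresentation

variable {n : ℕ} {X Y Z : Ban.{u, v} 𝕜} (P : InjPresentation Y)

/-- Every short exact sequence starting in `Y` maps to the injective presentation of `Y`. -/
theorem exists_mor (s : ExactSeq 1 Y Z) :
    ∃ γ : Z →L[𝕜] P.coker,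
      Diagram.Mor γ (ContinuousLinearMap.id 𝕜 Y) s.diagram P.toExactSeq.diagram := by
  obtain ⟨s, hk, hs⟩ := s
  cases s with | cons f t =>
  cases t with | last p =>
  -- `T` extends `ι` along `f`; then `π T` kills `f[Y] = ker p` and descends to the quotient `Z`.
  obtain ⟨T, hT⟩ := P.isInjective _ _ f (LinearMap.ker_eq_bot.1 hk)
    (by have := (Diagram.last p).isClosed_ker; rwa [← hs.1] at this) P.ι
  obtain ⟨γ, hγ⟩ := Ban.exists_factor p hs.2 (P.π ∘L T) fun x hx => by
    obtain ⟨y, rfl⟩ := hs.1.ge hx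
    have h3 : T (f y) = P.ι y := DFunLike.congr_fun hT y
    exact (congrArg P.π h3).trans (P.range_eq_ker.le ⟨y, rfl⟩)
  exact ⟨γ, T, hT.symm, (ContinuousLinearMap.ext hγ).symm⟩

/-- Two operators induced by morphisms to the injective presentation differ by a liftable
operator. -/
theorem sub_mem_liftable {s : ExactSeq 1 Y Z} {γ δ : Z →L[𝕜] P.coker}
    (hγ : Diagram.Mor γ (ContinuousLinearMap.id 𝕜 Y) s.diagram P.toExactSeq.diagram)
    (hδ : Diagram.Mor δ (ContinuousLinearMap.id 𝕜 Y) s.diagram P.toExactSeq.diagram) :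
    γ - δ ∈ liftable Z P.π := by
  obtain ⟨s, hk, hs⟩ := s
  cases s with | cons f t =>
  cases t with | last p =>
  obtain ⟨T, hT, hT'⟩ := hγ
  obtain ⟨S, hS, hS'⟩ := hδ
  -- `T` and `S` both extend `ι`, so `T - S` vanishes on `ker p` and descends to `χ`, the required
  -- lifting of `γ - δ`.
  obtain ⟨χ, hχ⟩ := Ban.exists_factor p hs.2 (T - S) fun x hx => by
    obtain ⟨y, rfl⟩ := hs.1.ge hx
    exact sub_eq_zero.2 ((DFunLike.congr_fun hT y).symm.trans (DFunLike.congr_fun hS y))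
  refine ⟨χ, ContinuousLinearMap.ext fun z => ?_⟩
  obtain ⟨x, rfl⟩ := hs.2 z
  have h1 : P.π (T x) = γ (p x) := DFunLike.congr_fun hT' x
  have h2 : P.π (S x) = δ (p x) := DFunLike.congr_fun hS' x
  have h3 : P.π (χ (p x)) = P.π (T x) - P.π (S x) := by
    rw [hχ x, ← map_sub]
    rfl
  rw [h1, h2] at h3
  exact h3

/-- The difference of the two pushouts factors through `Ext(X, I) = 0`. -/
theorem push_eq_push {s : ExactSeq 1 Y Z} {γ δ : Z →L[𝕜] P.coker}
    (hγ : Diagram.Mor γ (ContinuousLinearMap.id 𝕜 Y) s.diagram P.toExactSeq.diagram)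
    (hδ : Diagram.Mor δ (ContinuousLinearMap.id 𝕜 Y) s.diagram P.toExactSeq.diagram)
    (x : Ext (n + 1) X Z) : Ext.push γ x = Ext.push δ x := by
  obtain ⟨χ, hχ⟩ := P.sub_mem_liftable hγ hδ
  have h : γ = P.π ∘L χ + δ := eq_add_of_sub_eq hχ.symm
  rw [h, Ext.add_push, ← Ext.push_push, Ext.eq_zero_of_isInjective P.isInjective (Ext.push χ x),
    Ext.push_map_zero, zero_add]

/-- `P.Rel E z` says that `z` is the pushout of the tail of `E` along an operator induced by a
morphism from the head of `E` to the injective presentation `P`. -/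
def Rel (E : ExactSeq (n + 2) Y X) (z : Ext (n + 1) X P.coker) : Prop :=
  ∃ (Z : Ban.{u, v} 𝕜) (s : ExactSeq 1 Y Z) (d : ExactSeq (n + 1) Z X) (γ : Z →L[𝕜] P.coker),
    E = s.splice d ∧
      Diagram.Mor γ (ContinuousLinearMap.id 𝕜 Y) s.diagram P.toExactSeq.diagram ∧
      Ext.push γ (Ext.mk d) = z

theorem exists_rel (E : ExactSeq (n + 2) Y X) : ∃ z, P.Rel E z := by
  obtain ⟨Z, s, d, h⟩ := E.exists_eq_splice
  obtain ⟨γ, hγ⟩ := P.exists_mor s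
  exact ⟨_, Z, s, d, γ, h, hγ, rfl⟩

variable {P}

/-- With the identity morphism this says that `z` is determined by `E`; in general it says that `z`
depends only on the class of `E`. The operator `χ` joining the two cut points carries `d` to `d'`,
and both `γ` and `γ' χ` come from morphisms of `s` to the presentation. -/
theorem Rel.eq_of_hom {E F : ExactSeq (n + 2) Y X} {z w : Ext (n + 1) X P.coker}
    (hz : P.Rel E z) (hw : P.Rel F w) (h : E.Hom F) : z = w := by
  obtain ⟨Z, s, d, γ, rfl, hγ, rfl⟩ := hz
  obtain ⟨Z', s', d', γ', rfl, hγ', rfl⟩ := hw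
  obtain ⟨χ, h1, h2⟩ := ExactSeq.exists_mor_of_hom_splice h
  have h3 : Ext.push χ (Ext.mk d) = Ext.mk d' := Ext.pushout_mk_eq h2
  rw [← h3, Ext.push_push]
  exact P.push_eq_push hγ (Diagram.Mor.comp h1 hγ') _

theorem Rel.splice_eq {E : ExactSeq (n + 2) Y X} {z : Ext (n + 1) X P.coker} (h : P.Rel E z) :
    Ext.splice P.toExactSeq z = Ext.mk E := by
  obtain ⟨Z, s, d, γ, rfl, hγ, rfl⟩ := h
  exact (Ext.push_splice hγ (Ext.mk d)).symm.trans (Ext.push_id (n := n + 1) _)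

theorem rel_splice (F : ExactSeq (n + 1) P.coker X) :
    P.Rel (P.toExactSeq.splice F) (Ext.mk F) :=
  ⟨_, P.toExactSeq, F, ContinuousLinearMap.id 𝕜 _, rfl, Diagram.Mor.refl _, Ext.push_id _⟩

variable (P)

/-- The dimension shift: splicing with an injective presentation is bijective on classes. -/
theorem splice_bijective :
    Function.Bijective
      (Ext.splice P.toExactSeq : Ext (n + 1) X P.coker → Ext (n + 2) X Y) := by
  -- `r` depends on arbitrary choices of cut and extension; `Rel.eq_of_hom` makes it descend to
  -- classes.
  choose r hr using P.exists_rel (n := n) (X := X)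
  let R : Ext (n + 2) X Y → Ext (n + 1) X P.coker :=
    Quot.lift r fun E F h => (hr E).eq_of_hom (hr F) h
  refine Function.bijective_iff_has_inverse.2 ⟨R, fun x => ?_, fun y => ?_⟩
  · obtain ⟨F, rfl⟩ := Quot.exists_rep x
    exact (hr _).eq_of_hom (rel_splice F) (Diagram.Mor.refl _)
  · obtain ⟨E, rfl⟩ := Quot.exists_rep y
    exact (hr E).splice_eq

/-- The dimension shift isomorphism. -/
def spliceEquiv : Ext (n + 1) X P.coker ≃ₗ[𝕜] Ext (n + 2) X Y :=
  LinearEquiv.ofBijective (Ext.spliceₗ P.toExactSeq) P.splice_bijective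

/-! ### The connecting map onto `Ext¹` and its kernel. -/

/-- The connecting map: pullback of an injective presentation along an operator. -/
def connect : (X →L[𝕜] P.coker) →ₗ[𝕜] Ext 1 X Y where
  toFun a := Ext.pull (n := 0) a (Ext.mk P.toExactSeq)
  map_add' a b := Ext.add_pull (n := 0) a b _
  map_smul' c a := Ext.smul_pull (n := 0) c a _

theorem connect_eq {a : X →L[𝕜] P.coker} {E : ExactSeq 1 Y X}
    (h : Diagram.Mor a (ContinuousLinearMap.id 𝕜 Y) E.diagram P.toExactSeq.diagram) :
    P.connect a = Ext.mk E :=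
  Ext.pullback_mk_eq (n := 0) h

theorem connect_surjective : Function.Surjective (P.connect : (X →L[𝕜] P.coker) → Ext 1 X Y) := by
  intro y
  obtain ⟨E, rfl⟩ := Quot.exists_rep y
  obtain ⟨a, ha⟩ := P.exists_mor E
  exact ⟨a, P.connect_eq ha⟩

theorem connect_eq_zero_of_mem {a : X →L[𝕜] P.coker} (ha : a ∈ liftable X P.π) :
    P.connect a = 0 := by
  obtain ⟨h, rfl⟩ := ha
  -- A lifting `h` of `a` yields the middle arrow `(y, x) ↦ ι y + h x` from the split sequence to
  -- the presentation, over `a`.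
  refine P.connect_eq (E := ExactSeq.zero 0 Y X) ⟨P.ι.coprod h, ?_, ?_⟩
  · refine ContinuousLinearMap.ext fun y => ?_
    have : P.ι y = P.ι y + h 0 := by rw [map_zero, add_zero]
    exact this
  · refine ContinuousLinearMap.ext fun y => ?_
    have h1 : P.π (P.ι y.1) = 0 := P.range_eq_ker.le ⟨y.1, rfl⟩
    have : P.π (P.ι y.1 + h y.2) = P.π (h y.2) := by rw [map_add, h1, zero_add]
    exact this

/-- The map `R` is a left inverse of the connecting map modulo liftable operators: it sends a class
to any operator induced by a morphism to the presentation. Hence an operator with zero class is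
congruent to the zero operator. -/
theorem mem_of_connect_eq_zero {a : X →L[𝕜] P.coker} (ha : P.connect a = 0) :
    a ∈ liftable X P.π := by
  choose r hr using fun E : ExactSeq 1 Y X => P.exists_mor E
  let R : Ext 1 X Y → (X →L[𝕜] P.coker) ⧸ liftable X P.π :=
    Quot.lift (fun E => Submodule.Quotient.mk (r E)) fun E F h =>
      (Submodule.Quotient.eq _).2 (P.sub_mem_liftable (hr E) (Diagram.Mor.comp h (hr F)))
  have key : ∀ b : X →L[𝕜] P.coker, R (P.connect b) = Submodule.Quotient.mk b := fun b =>
    (Submodule.Quotient.eq _).2 (P.sub_mem_liftable (hr _)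
      (Diagram.pullback_mor b _ P.toExactSeq.exact))
  have h := key a
  rw [ha, ← map_zero P.connect, key 0] at h
  exact (Submodule.Quotient.mk_eq_zero _).1 h.symm

theorem ker_connect : (P.connect (X := X)).ker = liftable X P.π :=
  le_antisymm (fun _ => P.mem_of_connect_eq_zero) fun _ => P.connect_eq_zero_of_mem

/-- The isomorphism between the operators into `cκ(Y)` modulo the liftable ones and `Ext¹(X, Y)`. -/
def connectEquiv : ((X →L[𝕜] P.coker) ⧸ liftable X P.π) ≃ₗ[𝕜] Ext 1 X Y :=
  (Submodule.quotEquivOfEq _ _ P.ker_connect.symm).trans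
    (P.connect.quotKerEquivOfSurjective P.connect_surjective)

end InjPresentation

end BanachExt

end

/-- Indices are shifted so that lengths are visibly positive: the length written `n ≥ 1` in the text
is `n + 1` here, and `j ≥ 2` is `k + 2`. The explicit formulas hold by `rfl` because both
isomorphisms act on representatives. -/
theorem mainTheorem7 {𝕜 : Type v} [RCLike 𝕜]
    (P : (Y : Ban.{u, v} 𝕜) → InjPresentation Y) (X Y : Ban.{u, v} 𝕜) (n : ℕ) :
    (∀ i k : ℕ, i + (k + 2) = n + 1 →
      ∃ e : Ext (k + 1) X (cokerPow P (i + 1) Y) ≃ₗ[𝕜] Ext (k + 2) X (cokerPow P i Y),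
        ∀ F : ExactSeq (k + 1) (cokerPow P (i + 1) Y) X,
          e (Ext.mk F) = Ext.mk ((P (cokerPow P i Y)).toExactSeq.splice F)) ∧
    ∃ e : ((X →L[𝕜] cokerPow P (n + 1) Y) ⧸ liftable X (P (cokerPow P n Y)).π) ≃ₗ[𝕜]
        Ext 1 X (cokerPow P n Y),
      ∀ a : X →L[𝕜] cokerPow P (n + 1) Y,
        e (Submodule.Quotient.mk a) = Ext.mk ((P (cokerPow P n Y)).toExactSeq.pullback a) :=
  ⟨fun i _ _ => ⟨(P (cokerPow P i Y)).spliceEquiv, fun _ => rfl⟩,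
    (P (cokerPow P n Y)).connectEquiv, fun _ => rfl⟩
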